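/- Let $A=\sigma(R)\langle x_1,\dots,x_n\rangle$, $n\ge 1$, be a bijective skew PBW extension of a left noetherian (not necessarily commutative) domain $R$. That is: $R$ is a subring of the ring $A$; the monomials $x_1^{\alpha_1}\cdots x_n^{\alpha_n}$, $\alpha\in\mathbb{N}^n$, form a basis of $A$ as a left $R$-module; for all $i$ and all $0\neq r\in R$ there is $0\neq c_{i,r}\in R$ with $x_ir-c_{i,r}x_i\in R$; for all $i,j$ there is $0\neq c_{i,j}\in R$ with $x_jx_i-c_{i,j}x_ix_j\in R+Rx_1+\cdots+Rx_n$; and, moreover, the maps $\sigma_i:R\to R$ determined by $x_ir-\sigma_i(r)x_i\in R$ $(r\in R)$ are bijective and all $c_{i,j}$ are invertible in $R$. For $f\in A$ let $V(f)$ be the set of all $Z=(z_1,\dots,z_n)\in R^n$ such that $f$ lies in the two-sided ideal of $A$ generated by $x_1-z_1,\dots,x_n-z_n$. Call $X\subseteq R^n$ algebraic if $X=R^n$ or $X\subseteq V(g)$ for some $0\neq g\in A$. Then: (i) There is a topology on $R^n$ (the "Zariski topology") whose closed sets are exactly the algebraic subsets of $R^n$; in particular, finite unions and arbitrary intersections of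 algebraic sets are algebraic. (ii) Every finite subset of $R^n$ is algebraic, and hence closed in this topology. -/

import Mathlib

open scoped Topology

namespace SkewPBW

variable {A : Type*} [Ring A] {n : ℕ}

/-- The standard monomial `x^α = x₁^{α₁} ⋯ xₙ^{αₙ}`, the factors being taken in this order. -/
def mon (x : Fin n → A) (α : Fin n → ℕ) : A :=
  (List.ofFn fun i => x i ^ α i).prod

/-- `A` is a skew PBW extension of its subring `R` with respect to `x₁, …, xₙ`,
that is, `A = σ(R)⟨x₁, …, xₙ⟩`. -/
structure IsSkewPBW (R : Subring A) (x : Fin n → A) : Prop where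
  /-- The standard monomials are left linearly independent over `R` … -/
  linearIndependent : LinearIndependent R (mon x)
  /-- … and generate `A` as a left `R`-module: they form a basis of `A`, which is free. -/
  span_eq_top : Submodule.span R (Set.range (mon x)) = ⊤
  /-- For `r ≠ 0` in `R` there is `c ≠ 0` in `R` with `xᵢ r - c xᵢ ∈ R`. -/
  var_mul_coeff : ∀ (i : Fin n) (r : R), r ≠ 0 → ∃ c : R, c ≠ 0 ∧ x i * r - c * x i ∈ R
  /-- There is `c ≠ 0` in `R` with `xⱼ xᵢ - c xᵢ xⱼ ∈ R + R x₁ + ⋯ + R xₙ`. -/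
  var_mul_var : ∀ i j : Fin n, ∃ c : R, c ≠ 0 ∧
    x j * x i - c * x i * x j ∈ Submodule.span R (insert 1 (Set.range x))

/-- The skew PBW extension `A = σ(R)⟨x₁, …, xₙ⟩` is bijective: the maps `σᵢ` are bijective and the
constants `c_{i,j}` are invertible. As the standard monomials form a basis, `σᵢ` and `c_{i,j}` are
determined by the relations that are written here; in particular `σᵢ` is then
automatically a ring endomorphism of `R`. -/
structure IsBijectiveSkewPBW (R : Subring A) (x : Fin n → A) : Prop extends IsSkewPBW R x where
  sigma_bijective : ∀ i : Fin n, ∃ σ : R → R, Function.Bijective σ ∧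
    ∀ r : R, x i * r - σ r * x i ∈ R
  isUnit_coeff : ∀ i j : Fin n, ∃ c : R, IsUnit c ∧
    x j * x i - c * x i * x j ∈ Submodule.span R (insert 1 (Set.range x))

/-- The two-sided ideal `⟨Z⟩ = ⟨x₁ - z₁, …, xₙ - zₙ⟩` of `A`. -/
def pointIdeal {R : Subring A} (x : Fin n → A) (Z : Fin n → R) : TwoSidedIdeal A :=
  TwoSidedIdeal.span (Set.range fun i => x i - (Z i : A))

/-- `Z ∈ Rⁿ` is a root of `f`, written `f(Z) = 0`, if `f ∈ ⟨Z⟩`. -/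
def IsRoot {R : Subring A} (x : Fin n → A) (f : A) (Z : Fin n → R) : Prop :=
  f ∈ pointIdeal x Z

/-- The vanishing set `V(f) ⊆ Rⁿ`. -/
def vanishingSet (R : Subring A) (x : Fin n → A) (f : A) : Set (Fin n → R) :=
  {Z | IsRoot x f Z}

/-- `X ⊆ Rⁿ` is algebraic if `X = Rⁿ` or `X ⊆ V(g)` for some `g ≠ 0` in `A`. -/
def IsAlgebraicSet (R : Subring A) (x : Fin n → A) (X : Set (Fin n → R)) : Prop :=
  X = Set.univ ∨ ∃ g : A, g ≠ 0 ∧ X ⊆ vanishingSet R x g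

end SkewPBW

/-! Any subset of some `V(g)`, `g ≠ 0`, is algebraic, so a single proper member settles an
intersection. Since `⟨Z⟩` is two-sided, `V(f) ∪ V(g) ⊆ V(fg)`, and a point `Z` lies in `V(x₁ - z₁)`.
What remains is `fg ≠ 0`, that is, `A` has no zero divisors (`IsSkewPBW.mul_ne_zero`). This rests on
`IsSkewPBW.mon_mul_term`: modulo lower total degree, `x^α r x^β` is a nonzero multiple of `x^(α+β)`.
Among the top-degree exponents of `f` and `g`, some pair has a sum attained only once, and the
coefficient of `fg` there is nonzero. -/

namespace SkewPBW

/-! ### Standard monomials. -/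

section Monomials

variable {A : Type*} [Ring A]

theorem mon_zero {n : ℕ} (x : Fin n → A) : mon x 0 = 1 := by
  simp [mon, List.ofFn_const]

theorem mon_succ {n : ℕ} (x : Fin (n + 1) → A) (α : Fin (n + 1) → ℕ) :
    mon x α = x 0 ^ α 0 * mon (fun i => x i.succ) (fun i => α i.succ) := by
  simp [mon, List.ofFn_succ]

/-- Left multiplication by a variable that precedes all variables of a monomial. -/
theorem var_mul_mon_of_le {n : ℕ} (x : Fin n → A) (i : Fin n) (α : Fin n → ℕ)
    (h : ∀ j < i, α j = 0) : x i * mon x α = mon x (α + Pi.single i 1) := by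
  induction n with
  | zero => exact i.elim0
  | succ n ih =>
    rw [mon_succ, mon_succ]
    induction i using Fin.cases with
    | zero =>
      have : (fun i : Fin n => (α + Pi.single 0 1 : Fin (n + 1) → ℕ) i.succ) =
          fun i => α i.succ := by
        funext i
        simp
      rw [this]
      simp [pow_succ', mul_assoc]
    | succ k =>
      have h0 : α 0 = 0 := h 0 (Fin.succ_pos k)
      have : (fun i : Fin n => (α + Pi.single k.succ 1 : Fin (n + 1) → ℕ) i.succ) =
          (fun i => α i.succ) + Pi.single k 1 := by
        funext i
        simp [Pi.single_apply]
      rw [this, ← ih (fun i => x i.succ) k _ fun j hj => h j.succ (Fin.succ_lt_succ_iff.2 hj)]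
      simp [h0]

theorem mon_single {n : ℕ} (x : Fin n → A) (i : Fin n) : mon x (Pi.single i 1) = x i := by
  simpa [mon_zero] using (var_mul_mon_of_le x i 0 fun _ _ => rfl).symm

/-- A nonzero exponent has a first variable, which can be split off. -/
theorem exists_eq_add_single {n : ℕ} {α : Fin n → ℕ} (h : α ≠ 0) :
    ∃ (j : Fin n) (β : Fin n → ℕ), α = β + Pi.single j 1 ∧ ∀ k < j, β k = 0 := by
  have hex : ∃ j, α j ≠ 0 := Function.ne_iff.1 h
  obtain ⟨j, hj, hmin⟩ := WellFounded.has_min (wellFounded_lt (α := Fin n)) {j | α j ≠ 0} hex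
  refine ⟨j, α - Pi.single j 1, ?_, fun k hk => ?_⟩
  · funext k
    rcases eq_or_ne k j with rfl | hk
    · have : α k ≠ 0 := hj
      simp
      omega
    · simp [hk]
  · have : α k = 0 := by
      by_contra hne
      exact hmin k hne hk
    simp [this]

end Monomials

/-! ### Degree filtration and leading terms of products. -/

section Filtration

variable {A : Type*} [Ring A] {n : ℕ}

/-- The total degree of an exponent. -/
def deg (α : Fin n → ℕ) : ℕ := ∑ i, α i

theorem deg_add (α β : Fin n → ℕ) : deg (α + β) = deg α + deg β := by
  simp [deg, Finset.sum_add_distrib]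

theorem deg_single (i : Fin n) : deg (Pi.single i 1 : Fin n → ℕ) = 1 := by
  simp [deg]

/-- The left `R`-submodule spanned by the standard monomials of degree less than `d`. -/
def degLT (R : Subring A) (x : Fin n → A) (d : ℕ) : Submodule R A :=
  Submodule.span R (mon x '' {α | deg α < d})

variable {R : Subring A} {x : Fin n → A}

theorem degLT_mono {d e : ℕ} (h : d ≤ e) : degLT R x d ≤ degLT R x e :=
  Submodule.span_mono (Set.image_mono fun _ hα => lt_of_lt_of_le hα h)

theorem mon_mem_degLT {α : Fin n → ℕ} {d : ℕ} (h : deg α < d) : mon x α ∈ degLT R x d :=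
  Submodule.subset_span ⟨α, h, rfl⟩

theorem coe_mul_mem {M : Submodule R A} (r : R) {a : A} (h : a ∈ M) : (r : A) * a ∈ M :=
  M.smul_mem r h

theorem mul_mem_of_mem {M : Submodule R A} {r a : A} (hr : r ∈ R) (h : a ∈ M) : r * a ∈ M :=
  M.smul_mem (⟨r, hr⟩ : R) h

/-- To bound `xⱼ F` for a step `F` of the filtration it suffices to treat monomials. -/
theorem IsSkewPBW.var_mul_mem (hA : IsSkewPBW R x) (j : Fin n) {d e : ℕ} (hde : d ≤ e)
    (h : ∀ α, deg α < d → x j * mon x α ∈ degLT R x e) {a : A} (ha : a ∈ degLT R x d) :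
    x j * a ∈ degLT R x e := by
  induction ha using Submodule.span_induction with
  | mem a ha =>
    obtain ⟨α, hα, rfl⟩ := ha
    exact h α hα
  | zero => simp
  | add a b _ _ iha ihb =>
    rw [mul_add]
    exact add_mem iha ihb
  | smul r a ha ih =>
    rcases eq_or_ne r 0 with rfl | hr
    · simp
    · obtain ⟨c, -, hc⟩ := hA.var_mul_coeff j r hr
      have : x j * (r • a) = c * (x j * a) + (x j * r - c * x j) * a := by
        rw [Subring.smul_def, smul_eq_mul]
        noncomm_ring
      rw [this]
      -- The remainder lies in `R`, so it leaves `a` in step `d`; hence the need for `d ≤ e`.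
      exact add_mem (coe_mul_mem c ih) (mul_mem_of_mem hc (degLT_mono hde ha))

variable [IsDomain R]

/-- The leading term of `xᵢ x^α`. -/
theorem IsSkewPBW.var_mul_mon (hA : IsSkewPBW R x) (i : Fin n) (α : Fin n → ℕ) :
    ∃ c : R, c ≠ 0 ∧
      x i * mon x α - c * mon x (α + Pi.single i 1) ∈ degLT R x (deg α + 1) := by
  induction hd : deg α using Nat.strong_induction_on generalizing i α with
  | _ d ih =>
  -- Coarse bound for the linear terms `R xₖ` that appear when two variables are swapped.
  have ih' : ∀ (k : Fin n) (β : Fin n → ℕ), deg β < d →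
      x k * mon x β ∈ degLT R x (deg β + 2) := by
    intro k β hβ
    obtain ⟨c, -, hc⟩ := ih _ hβ k β rfl
    have := add_mem (degLT_mono (by omega : deg β + 1 ≤ deg β + 2) hc)
      (coe_mul_mem c (mon_mem_degLT (R := R) (x := x) (α := β + Pi.single k 1)
        (d := deg β + 2) (by rw [deg_add, deg_single]; omega)))
    simpa using this
  -- Either `xᵢ x^α` is already standard, or `xᵢ` must be moved past the first variable `xⱼ` of
  -- `x^α`, where `j < i`.
  by_cases hi : ∀ j < i, α j = 0
  · exact ⟨1, one_ne_zero, by simp [var_mul_mon_of_le x i α hi]⟩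
  · have hα : α ≠ 0 := fun h => hi fun j _ => by simp [h]
    obtain ⟨j, β, rfl, hβ⟩ := exists_eq_add_single hα
    have hji : j < i := by
      by_contra hle
      refine hi fun k hk => ?_
      have hkj : k < j := lt_of_lt_of_le hk (not_lt.1 hle)
      simp [hβ k hkj, hkj.ne]
    have hdeg : deg β + 1 = d := by rw [← hd, deg_add, deg_single]
    obtain ⟨c, hc0, hc⟩ := hA.var_mul_var j i
    obtain ⟨c', hc0', hc'⟩ := ih (deg β) (by omega) i β rfl
    obtain ⟨s, hs0, hs⟩ := hA.var_mul_coeff j c' hc0'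
    refine ⟨c * s, mul_ne_zero hc0 hs0, ?_⟩
    have hγ : x j * mon x (β + Pi.single i 1) = mon x (β + Pi.single j 1 + Pi.single i 1) := by
      rw [var_mul_mon_of_le, add_right_comm]
      intro k hk
      simp [hβ k hk, (hk.trans hji).ne]
    have h1 : ∀ p ∈ Submodule.span R (insert 1 (Set.range x)),
        p * mon x β ∈ degLT R x (d + 1) := by
      intro p hp
      induction hp using Submodule.span_induction with
      | mem p hp =>
        rcases hp with rfl | ⟨k, rfl⟩
        · rw [one_mul]
          exact mon_mem_degLT (by omega)
        · exact degLT_mono (by omega) (ih' k β (by omega))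
      | zero => simp
      | add a b _ _ iha ihb =>
        rw [add_mul]
        exact add_mem iha ihb
      | smul r a _ iha =>
        rw [smul_mul_assoc]
        exact Submodule.smul_mem _ r iha
    have h2 : x j * (x i * mon x β - c' * mon x (β + Pi.single i 1)) ∈ degLT R x (d + 1) := by
      refine hA.var_mul_mem j (d := deg β + 1) (by omega) (fun γ hγ => ?_) hc'
      exact degLT_mono (by omega) (ih' j γ (by omega))
    have h3 : (x j * c' - s * x j) * mon x (β + Pi.single i 1) ∈ degLT R x (d + 1) :=
      mul_mem_of_mem hs (mon_mem_degLT (by rw [deg_add, deg_single]; omega))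
    have key : x i * mon x (β + Pi.single j 1) -
        (c * s : R) * mon x (β + Pi.single j 1 + Pi.single i 1) =
        (x i * x j - c * x j * x i) * mon x β +
        (c * (x j * (x i * mon x β - c' * mon x (β + Pi.single i 1))) +
        c * ((x j * c' - s * x j) * mon x (β + Pi.single i 1))) := by
      rw [← hγ, ← var_mul_mon_of_le x j β hβ, Subring.coe_mul]
      noncomm_ring
    rw [key]
    exact add_mem (h1 _ hc) (add_mem (coe_mul_mem c h2) (coe_mul_mem c h3))

theorem IsSkewPBW.var_mul_mem_degLT (hA : IsSkewPBW R x) (j : Fin n) {d : ℕ} {a : A}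
    (ha : a ∈ degLT R x d) : x j * a ∈ degLT R x (d + 1) := by
  refine hA.var_mul_mem j (by omega) (fun α hα => ?_) ha
  obtain ⟨c, -, hc⟩ := hA.var_mul_mon j α
  have := add_mem (degLT_mono (by omega : deg α + 1 ≤ d + 1) hc)
    (coe_mul_mem c (mon_mem_degLT (R := R) (x := x) (α := α + Pi.single j 1)
      (d := d + 1) (by rw [deg_add, deg_single]; omega)))
  simpa using this

/-- The leading term of `xᵢ r x^α` for `r ≠ 0`. -/
theorem IsSkewPBW.var_mul_term (hA : IsSkewPBW R x) (i : Fin n) {r : R} (hr : r ≠ 0)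
    (α : Fin n → ℕ) : ∃ c : R, c ≠ 0 ∧
      x i * (r * mon x α) - c * mon x (α + Pi.single i 1) ∈ degLT R x (deg α + 1) := by
  obtain ⟨s, hs0, hs⟩ := hA.var_mul_coeff i r hr
  obtain ⟨c, hc0, hc⟩ := hA.var_mul_mon i α
  refine ⟨s * c, mul_ne_zero hs0 hc0, ?_⟩
  have key : x i * (r * mon x α) - (s * c : R) * mon x (α + Pi.single i 1) =
      s * (x i * mon x α - c * mon x (α + Pi.single i 1)) +
      (x i * r - s * x i) * mon x α := by
    rw [Subring.coe_mul]
    noncomm_ring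
  rw [key]
  exact add_mem (coe_mul_mem s hc) (mul_mem_of_mem hs (mon_mem_degLT (by omega)))

/-- The leading term of `x^α r x^β` for `r ≠ 0`. -/
theorem IsSkewPBW.mon_mul_term (hA : IsSkewPBW R x) (α : Fin n → ℕ) {r : R} (hr : r ≠ 0)
    (β : Fin n → ℕ) : ∃ c : R, c ≠ 0 ∧
      mon x α * (r * mon x β) - c * mon x (α + β) ∈ degLT R x (deg α + deg β) := by
  induction hd : deg α generalizing α with
  | zero =>
    have : α = 0 := by
      funext i
      exact (Finset.sum_eq_zero_iff.1 hd) i (Finset.mem_univ i)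
    subst this
    exact ⟨r, hr, by simp [mon_zero]⟩
  | succ d ih =>
    have hα : α ≠ 0 := by
      rintro rfl
      simp [deg] at hd
    obtain ⟨j, γ, rfl, hγ⟩ := exists_eq_add_single hα
    have hdeg : deg γ = d := by
      rw [deg_add, deg_single] at hd
      omega
    obtain ⟨c, hc0, hc⟩ := ih γ hdeg
    obtain ⟨s, hs0, hs⟩ := hA.var_mul_term j hc0 (γ + β)
    refine ⟨s, hs0, ?_⟩
    rw [← var_mul_mon_of_le x j γ hγ, add_right_comm γ]
    have key : x j * mon x γ * (r * mon x β) - s * mon x (γ + β + Pi.single j 1) =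
        x j * (mon x γ * (r * mon x β) - c * mon x (γ + β)) +
        (x j * (c * mon x (γ + β)) - s * mon x (γ + β + Pi.single j 1)) := by
      noncomm_ring
    rw [key]
    refine add_mem (degLT_mono (by omega) (hA.var_mul_mem_degLT j hc)) ?_
    rw [deg_add, hdeg] at hs
    exact degLT_mono (by omega) hs

end Filtration

/-! ### Absence of zero divisors. -/

section Domain

variable {A : Type*} [Ring A] {n : ℕ} {R : Subring A} {x : Fin n → A}

/-- The basis of standard monomials. -/
noncomputable def IsSkewPBW.basis (hA : IsSkewPBW R x) : Module.Basis (Fin n → ℕ) R A :=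
  Module.Basis.mk hA.linearIndependent hA.span_eq_top.ge

theorem IsSkewPBW.basis_apply (hA : IsSkewPBW R x) (α : Fin n → ℕ) :
    hA.basis α = mon x α := by
  simp [IsSkewPBW.basis]

theorem IsSkewPBW.repr_mon (hA : IsSkewPBW R x) (α : Fin n → ℕ) :
    hA.basis.repr (mon x α) = Finsupp.single α 1 := by
  rw [← hA.basis_apply, Module.Basis.repr_self]

theorem IsSkewPBW.repr_coe_mul (hA : IsSkewPBW R x) (r : R) (a : A) (α : Fin n → ℕ) :
    hA.basis.repr (r * a) α = r * hA.basis.repr a α := by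
  have : (r : A) * a = r • a := rfl
  rw [this, map_smul, Finsupp.smul_apply, smul_eq_mul]

theorem IsSkewPBW.repr_eq_zero_of_mem_degLT (hA : IsSkewPBW R x) {d : ℕ} {a : A}
    (ha : a ∈ degLT R x d) {α : Fin n → ℕ} (hα : d ≤ deg α) : hA.basis.repr a α = 0 := by
  induction ha using Submodule.span_induction with
  | mem a ha =>
    obtain ⟨β, hβ, rfl⟩ := ha
    have hne : β ≠ α := by
      rintro rfl
      exact absurd hβ (not_lt.2 hα)
    rw [hA.repr_mon, Finsupp.single_eq_of_ne' hne]
  | zero => simp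
  | add a b _ _ iha ihb => simp [iha, ihb]
  | smul r a _ ih => simp [ih]

theorem IsSkewPBW.eq_sum (hA : IsSkewPBW R x) (f : A) :
    f = ∑ α ∈ (hA.basis.repr f).support, (hA.basis.repr f α : A) * mon x α := by
  conv_lhs => rw [← hA.basis.linearCombination_repr f]
  rw [Finsupp.linearCombination_apply, Finsupp.sum]
  refine Finset.sum_congr rfl fun α _ => ?_
  rw [hA.basis_apply]
  rfl

/-- The exponents of maximal degree in a nonzero element. -/
theorem IsSkewPBW.exists_deg_max (hA : IsSkewPBW R x) {f : A} (hf : f ≠ 0) :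
    ∃ d : ℕ, (∀ α ∈ (hA.basis.repr f).support, deg α ≤ d) ∧
      ((hA.basis.repr f).support.filter fun α => deg α = d).Nonempty := by
  have hne : (hA.basis.repr f).support.Nonempty := by
    simpa [Finsupp.support_nonempty_iff] using hf
  obtain ⟨α, hα, hmax⟩ := Finset.exists_max_image _ deg hne
  exact ⟨deg α, hmax, α, by simpa using hα⟩

/-- A skew PBW extension of a domain has no zero divisors. -/
theorem IsSkewPBW.mul_ne_zero [IsDomain R] (hA : IsSkewPBW R x) {f g : A} (hf : f ≠ 0)
    (hg : g ≠ 0) : f * g ≠ 0 := by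
  obtain ⟨d, hd, hS⟩ := hA.exists_deg_max hf
  obtain ⟨e, he, hT⟩ := hA.exists_deg_max hg
  -- Unique sums in `ℕⁿ` replace a monomial order: no other pair of top-degree exponents sums to `α₀
  -- + β₀`.
  obtain ⟨α₀, hα₀, β₀, hβ₀, huniq⟩ := UniqueSums.uniqueAdd_of_nonempty hS hT
  rw [Finset.mem_filter] at hα₀ hβ₀
  set F := hA.basis.repr f
  set G := hA.basis.repr g
  have hcoef : ∀ α ∈ F.support, ∀ β ∈ G.support,
      (hA.basis.repr ((F α : A) * mon x α * (G β * mon x β)) (α₀ + β₀) ≠ 0 ↔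
        α = α₀ ∧ β = β₀) := by
    intro α hα β hβ
    obtain ⟨c, hc0, hc⟩ := hA.mon_mul_term α (Finsupp.mem_support_iff.1 hβ) β
    -- The lower-order remainder therefore cannot reach the coefficient at `α₀ + β₀`.
    have hle : deg α + deg β ≤ deg (α₀ + β₀) := by
      rw [deg_add, hα₀.2, hβ₀.2]
      exact add_le_add (hd α hα) (he β hβ)
    have h0 := hA.repr_eq_zero_of_mem_degLT hc hle
    rw [map_sub, Finsupp.sub_apply, sub_eq_zero] at h0
    rw [mul_assoc, hA.repr_coe_mul, h0, hA.repr_coe_mul, hA.repr_mon]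
    constructor
    · intro hne
      have hsum : α + β = α₀ + β₀ := by
        by_contra h
        rw [Finsupp.single_eq_of_ne' h] at hne
        simp at hne
      have hdsum : deg α + deg β = d + e := by
        rw [← deg_add, hsum, deg_add, hα₀.2, hβ₀.2]
      have h1 := hd α hα
      have h2 := he β hβ
      exact huniq (Finset.mem_filter.2 ⟨hα, by omega⟩) (Finset.mem_filter.2 ⟨hβ, by omega⟩) hsum
    · rintro ⟨rfl, rfl⟩
      rw [Finsupp.single_eq_same, mul_one]
      exact _root_.mul_ne_zero (Finsupp.mem_support_iff.1 hα) hc0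
  intro hfg
  have hrepr : hA.basis.repr (f * g) (α₀ + β₀) =
      hA.basis.repr ((F α₀ : A) * mon x α₀ * (G β₀ * mon x β₀)) (α₀ + β₀) := by
    conv_lhs => rw [hA.eq_sum f, hA.eq_sum g, Finset.sum_mul_sum]
    simp only [map_sum, Finsupp.finsetSum_apply]
    rw [Finset.sum_eq_single_of_mem α₀ hα₀.1, Finset.sum_eq_single_of_mem β₀ hβ₀.1]
    · intro β hβ hne
      by_contra h
      exact hne ((hcoef α₀ hα₀.1 β hβ).1 h).2
    · intro α hα hne
      refine Finset.sum_eq_zero fun β hβ => ?_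
      by_contra h
      exact hne ((hcoef α hα β hβ).1 h).1
  refine (hcoef α₀ hα₀.1 β₀ hβ₀.1).2 ⟨rfl, rfl⟩ ?_
  rw [← hrepr, hfg]
  simp

end Domain

/-! ### Algebraic sets. -/

section Algebraic

variable {A : Type*} [Ring A] {n : ℕ} {R : Subring A} {x : Fin n → A}

/-- This makes `xᵢ - zᵢ` a legitimate nonzero witness for a point: `xᵢ` and `1` are distinct basis
monomials. -/
theorem IsSkewPBW.var_ne_coe [Nontrivial R] (hA : IsSkewPBW R x) (i : Fin n) (z : R) :
    x i ≠ z := by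
  intro h
  have h0 : mon x (Pi.single i 1) = z * mon x 0 := by
    rw [mon_single, mon_zero, mul_one, h]
  have hne : (0 : Fin n → ℕ) ≠ Pi.single i 1 := fun h => by
    simpa using congrFun h i
  have := congrArg (fun a => hA.basis.repr a (Pi.single i 1)) h0
  simp only [hA.repr_coe_mul, hA.repr_mon, Finsupp.single_eq_same,
    Finsupp.single_eq_of_ne' hne, mul_zero] at this
  exact one_ne_zero this

theorem isAlgebraicSet_empty [Nontrivial R] : IsAlgebraicSet R x ∅ :=
  have : Nontrivial A := R.subtype_injective.nontrivial
  Or.inr ⟨1, one_ne_zero, Set.empty_subset _⟩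

theorem IsSkewPBW.isAlgebraicSet_union [IsDomain R] (hA : IsSkewPBW R x)
    {X Y : Set (Fin n → R)} (hX : IsAlgebraicSet R x X) (hY : IsAlgebraicSet R x Y) :
    IsAlgebraicSet R x (X ∪ Y) := by
  rcases hX with rfl | ⟨f, hf, hX⟩
  · exact Or.inl (Set.univ_union _)
  rcases hY with rfl | ⟨g, hg, hY⟩
  · exact Or.inl (Set.union_univ _)
  refine Or.inr ⟨f * g, hA.mul_ne_zero hf hg, Set.union_subset (fun Z hZ => ?_) fun Z hZ => ?_⟩
  · exact (pointIdeal x Z).mul_mem_right f g (hX hZ)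
  · exact (pointIdeal x Z).mul_mem_left f g (hY hZ)

theorem IsSkewPBW.isAlgebraicSet_sUnion [IsDomain R] (hA : IsSkewPBW R x)
    {S : Set (Set (Fin n → R))} (hS : S.Finite) (h : ∀ X ∈ S, IsAlgebraicSet R x X) :
    IsAlgebraicSet R x (⋃₀ S) := by
  induction S, hS using Set.Finite.induction_on with
  | empty =>
    rw [Set.sUnion_empty]
    exact isAlgebraicSet_empty
  | insert _ _ ih =>
    rw [Set.sUnion_insert]
    exact hA.isAlgebraicSet_union (h _ (Set.mem_insert _ _))
      (ih fun X hX => h X (Set.mem_insert_of_mem _ hX))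

theorem isAlgebraicSet_sInter {S : Set (Set (Fin n → R))}
    (h : ∀ X ∈ S, IsAlgebraicSet R x X) : IsAlgebraicSet R x (⋂₀ S) := by
  by_cases hS : ∀ X ∈ S, X = Set.univ
  · exact Or.inl (Set.sInter_eq_univ.2 hS)
  · push Not at hS
    obtain ⟨X, hX, hne⟩ := hS
    obtain ⟨g, hg, hXg⟩ := (h X hX).resolve_left hne
    exact Or.inr ⟨g, hg, (Set.sInter_subset_of_mem hX).trans hXg⟩

theorem IsSkewPBW.isAlgebraicSet_singleton [Nontrivial R] (hn : 1 ≤ n) (hA : IsSkewPBW R x)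
    (Z : Fin n → R) : IsAlgebraicSet R x {Z} := by
  refine Or.inr ⟨x ⟨0, hn⟩ - Z ⟨0, hn⟩, sub_ne_zero.2 (hA.var_ne_coe _ _), ?_⟩
  rintro _ rfl
  exact TwoSidedIdeal.subset_span ⟨_, rfl⟩

theorem IsSkewPBW.isAlgebraicSet_of_finite [IsDomain R] (hn : 1 ≤ n) (hA : IsSkewPBW R x)
    {X : Set (Fin n → R)} (hX : X.Finite) : IsAlgebraicSet R x X := by
  induction X, hX using Set.Finite.induction_on with
  | empty => exact isAlgebraicSet_empty
  | insert _ _ ih => exact hA.isAlgebraicSet_union (hA.isAlgebraicSet_singleton hn _) ih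

end Algebraic

end SkewPBW

theorem mainTheorem3 {A : Type*} [Ring A] (R : Subring A) [IsDomain R] [IsNoetherianRing R]
    {n : ℕ} (hn : 1 ≤ n) (x : Fin n → A) (hA : SkewPBW.IsBijectiveSkewPBW R x) :
    (∃ T : TopologicalSpace (Fin n → R),
      (∀ X : Set (Fin n → R), IsClosed[T] X ↔ SkewPBW.IsAlgebraicSet R x X) ∧
      (∀ X : Set (Fin n → R), X.Finite → IsClosed[T] X)) ∧
    (∀ S : Set (Set (Fin n → R)), S.Finite →
      (∀ X ∈ S, SkewPBW.IsAlgebraicSet R x X) → SkewPBW.IsAlgebraicSet R x (⋃₀ S)) ∧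
    (∀ S : Set (Set (Fin n → R)),
      (∀ X ∈ S, SkewPBW.IsAlgebraicSet R x X) → SkewPBW.IsAlgebraicSet R x (⋂₀ S)) ∧
    (∀ X : Set (Fin n → R), X.Finite → SkewPBW.IsAlgebraicSet R x X) := by
  have hA' := hA.toIsSkewPBW
  let T : TopologicalSpace (Fin n → R) :=
    TopologicalSpace.ofClosed {X | SkewPBW.IsAlgebraicSet R x X} SkewPBW.isAlgebraicSet_empty
      (fun _ hS => SkewPBW.isAlgebraicSet_sInter hS)
      (fun _ hX _ hY => hA'.isAlgebraicSet_union hX hY)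
  have hT : ∀ X : Set (Fin n → R), IsClosed[T] X ↔ SkewPBW.IsAlgebraicSet R x X := fun X => by
    rw [← @isOpen_compl_iff _ X T]
    change Xᶜᶜ ∈ {X | SkewPBW.IsAlgebraicSet R x X} ↔ _
    rw [compl_compl, Set.mem_ofPred_eq]
  have hfin : ∀ X : Set (Fin n → R), X.Finite → SkewPBW.IsAlgebraicSet R x X :=
    fun X hX => hA'.isAlgebraicSet_of_finite hn hX
  exact ⟨⟨T, hT, fun X hX => (hT X).2 (hfin X hX)⟩, fun S hS h => hA'.isAlgebraicSet_sUnion hS h,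
    fun S h => SkewPBW.isAlgebraicSet_sInter h, hfin⟩
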